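/- Let $r \ge 3$ be an integer. For $p \in (0,1)$ let $N$ be the number of independent Bernoulli trials with success probability $p$ needed to obtain $r$ successes, so that $$\Pr[N=n] = \frac{(n-1)(n-2)\cdots(n-r+1)}{(r-1)!}\, p^r (1-p)^{n-r}, \qquad n \ge r.$$ A (possibly randomized) estimator $\hat p$ of $p$ based on inverse binomial sampling is a positive random variable whose conditional distribution given $N=n$ is, for each $n \ge r$, a probability distribution $\Pi_n$ on $(0,\infty)$ that does not depend on $p$; non-randomized estimators $\hat p = g(N)$ with $g>0$ are the special case in which each $\Pi_n$ is the point mass at $g(n)$. Its normalized mean square error is $$\frac{\mathrm E[(\hat p-p)^2]}{p^2} = \frac{1}{p^2}\sum_{n=r}^{\infty} \Pr[N=n] \int_{(0,\infty)} (y-p)^2 \, \mathrm d\Pi_n(y) \in [0,\infty].$$ Then the non-randomized estimator $$\hat p = \frac{r-2}{N-1}$$ minimizes $\sup_{p\in(0,1)} \mathrm E[(\hat p-p)^2]/p^2$ among all (possibly randomized) estimators based on inverse binomial sampling, and the minimum value of this supremum is $1/(r-1)$. -/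

import Mathlib

open MeasureTheory
open scoped ENNReal

noncomputable section

namespace InverseBinomial

/-- The probability function `f(n) = Pr[N = n]`, `n ≥ r`, of the number `N` of Bernoulli trials with
success probability `p` that are needed to obtain `r ≥ 1` successes:
`f(n) = (n-1)(n-2)⋯(n-r+1) / (r-1)! * p^r * (1-p)^(n-r)`. -/
def sampleSizeProb (r : ℕ) (p : ℝ) (n : {n : ℕ // r ≤ n}) : ℝ :=
  (((n : ℕ) - 1).descFactorial (r - 1) : ℝ) / ((r - 1).factorial : ℝ)
    * p ^ r * (1 - p) ^ ((n : ℕ) - r)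

/-- A (possibly randomized) estimator based on `N`: to each `n ≥ r` it assigns the conditional
distribution of the positive random variable `p̂` given `N = n`, a probability distribution on the
line that is concentrated on `(0, ∞)`. -/
structure Estimator (r : ℕ) where
  /-- the conditional distribution of `p̂` given `N = n` -/
  law : {n : ℕ // r ≤ n} → ProbabilityMeasure ℝ
  /-- the estimator takes positive values -/
  law_pos : ∀ n, ∀ᵐ y ∂(law n : Measure ℝ), 0 < y

/-- The non-randomized estimator `p̂ = g(N)` with `g` positive: given `N = n`, it is the constant
`g(n)`. -/
def Estimator.ofFun {r : ℕ} (g : {n : ℕ // r ≤ n} → ℝ) (hg : ∀ n, 0 < g n) : Estimator r where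
  law n := ⟨Measure.dirac (g n), inferInstance⟩
  law_pos n := by
    rw [ProbabilityMeasure.coe_mk, ae_dirac_iff measurableSet_Ioi]
    exact hg n

/-- The expectation `E[h(p̂)] = ∑_{n ≥ r} f(n) E[h(p̂) | N = n] ∈ [0, ∞]` of a nonnegative function of
the estimator, when the success probability is `p`. -/
def Estimator.expect {r : ℕ} (G : Estimator r) (p : ℝ) (h : ℝ → ℝ≥0∞) : ℝ≥0∞ :=
  ∑' n : {n : ℕ // r ≤ n},
    ENNReal.ofReal (sampleSizeProb r p n) * ∫⁻ y, h y ∂(G.law n : Measure ℝ)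

/-- The normalized mean square error `E[(p̂ - p)^2] / p^2 ∈ [0, ∞]`. -/
def Estimator.nmse {r : ℕ} (G : Estimator r) (p : ℝ) : ℝ≥0∞ :=
  G.expect p (fun y => ENNReal.ofReal ((y - p) ^ 2)) / ENNReal.ofReal (p ^ 2)

/-- The guaranteed normalized mean square error `sup_{p ∈ (0,1)} E[(p̂ - p)^2] / p^2 ∈ [0, ∞]`. -/
def Estimator.supNmse {r : ℕ} (G : Estimator r) : ℝ≥0∞ :=
  ⨆ p ∈ Set.Ioo (0 : ℝ) 1, G.nmse p

/-- The non-randomized estimator `p̂ = (r - 2) / (N - 1)`, for `r ≥ 3`. -/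
def optEstimator (r : ℕ) (hr : 3 ≤ r) : Estimator r :=
  Estimator.ofFun (fun n => ((r : ℝ) - 2) / (((n : ℕ) : ℝ) - 1)) (by
    intro n
    have h1 : (3 : ℝ) ≤ (r : ℝ) := by exact_mod_cast hr
    have h2 : (r : ℝ) ≤ ((n : ℕ) : ℝ) := by exact_mod_cast n.2
    exact div_pos (by linarith) (by linarith))

end InverseBinomial

end

open MeasureTheory
open scoped ENNReal

namespace InverseBinomial

/-! Upper bound: expand the square. `E[1/(N-1)] = p/(r-1)` is exact, and `E[1/(N-1)^2]` is at most
`E[1/((N-1)(N-2))] = p^2/((r-1)(r-2))`; the resulting bound is `p^2/(r-1)` (`optEstimator_nmse_le`).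

Lower bound: a supremum dominates any average, here over the prior `δ p^(δ-1)`. Given `N = n`, the
posterior risk is a quadratic in the estimate `y`, minimized at `z = (r+δ-2)/(n+δ-1)`; since this
holds for each `y`, randomization cannot help. The Bayes risk is thus at least `1 - E[z/p]`, and
`E[z/p] ≤ (r+δ-2)/(r-1)`, leaving `(1-δ)/(r-1)` (`lintegral_posterior_le`, `one_le_supNmse_add`).
Let `δ → 0`. -/

/-! ### Negative binomial sums -/

/-- The sample sizes `n ≥ r` are the numbers `k + r`. -/
def sampleSizeEquiv (r : ℕ) : ℕ ≃ {n : ℕ // r ≤ n} where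
  toFun k := ⟨k + r, Nat.le_add_left r k⟩
  invFun n := n - r
  left_inv k := by simp
  right_inv n := by
    ext
    exact Nat.sub_add_cancel n.2

theorem hasSum_sampleSize_iff {r : ℕ} {F : {n : ℕ // r ≤ n} → ℝ} {a : ℝ} :
    HasSum (fun k : ℕ => F ⟨k + r, Nat.le_add_left r k⟩) a ↔ HasSum F a :=
  (sampleSizeEquiv r).hasSum_iff

theorem sampleSizeProb_add (m k : ℕ) (p : ℝ) :
    sampleSizeProb (m + 1) p ⟨k + (m + 1), Nat.le_add_left _ _⟩
      = ((k + m).choose m : ℝ) * p ^ (m + 1) * (1 - p) ^ k := by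
  have h : (m.factorial : ℝ) ≠ 0 := by exact_mod_cast m.factorial_ne_zero
  simp only [sampleSizeProb, Nat.add_sub_cancel, ← Nat.add_assoc]
  rw [Nat.descFactorial_eq_factorial_mul_choose]
  have h2 : k + m + 1 - (m + 1) = k := by omega
  rw [h2]
  push_cast
  field_simp

theorem sampleSizeProb_nonneg (r : ℕ) {p : ℝ} (h0 : 0 < p) (h1 : p < 1) (n : {n : ℕ // r ≤ n}) :
    0 ≤ sampleSizeProb r p n := by
  have : 0 ≤ 1 - p := by linarith
  unfold sampleSizeProb
  positivity

theorem hasSum_sampleSizeProb_add (m : ℕ) {p : ℝ} (h0 : 0 < p) (h1 : p < 1) :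
    HasSum (fun k : ℕ => ((k + m).choose m : ℝ) * p ^ (m + 1) * (1 - p) ^ k) 1 := by
  have hn : ‖1 - p‖ < 1 := by
    rw [Real.norm_eq_abs, abs_lt]
    constructor <;> linarith
  have h := (hasSum_choose_mul_geometric_of_norm_lt_one m hn).mul_left (p ^ (m + 1))
  rw [sub_sub_cancel, mul_one_div_cancel (pow_ne_zero _ h0.ne')] at h
  refine h.congr_fun ?_
  intro k
  ring

theorem hasSum_sampleSizeProb {r : ℕ} (hr : 1 ≤ r) {p : ℝ} (h0 : 0 < p) (h1 : p < 1) :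
    HasSum (sampleSizeProb r p) 1 := by
  obtain ⟨m, rfl⟩ : ∃ m, r = m + 1 := ⟨r - 1, by omega⟩
  rw [← hasSum_sampleSize_iff]
  simpa only [sampleSizeProb_add] using hasSum_sampleSizeProb_add m h0 h1

theorem choose_succ_succ_div (n m : ℕ) :
    ((n + 1).choose (m + 1) : ℝ) / ((n : ℝ) + 1) = (n.choose m : ℝ) / ((m : ℝ) + 1) := by
  have h : ((n : ℝ) + 1) * (n.choose m : ℝ) = ((n + 1).choose (m + 1) : ℝ) * ((m : ℝ) + 1) := by
    exact_mod_cast Nat.add_one_mul_choose_eq n m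
  rw [div_eq_div_iff (by positivity) (by positivity), ← h]
  ring

/-- `E[1 / (N - 1)] = p / (r - 1)`. -/
theorem hasSum_sampleSizeProb_div {r : ℕ} (hr : 2 ≤ r) {p : ℝ} (h0 : 0 < p) (h1 : p < 1) :
    HasSum (fun n : {n : ℕ // r ≤ n} => sampleSizeProb r p n / (((n : ℕ) : ℝ) - 1))
      (p / ((r : ℝ) - 1)) := by
  obtain ⟨m, rfl⟩ : ∃ m, r = m + 1 + 1 := ⟨r - 2, by omega⟩
  rw [← hasSum_sampleSize_iff]
  -- Dividing by `n - 1` turns the law for `r` into `p/(r-1)` times the law for `r - 1`.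
  have h := (hasSum_sampleSizeProb_add m h0 h1).mul_left (p / ((m : ℝ) + 1))
  have e : (((m + 1 + 1 : ℕ) : ℝ) - 1) = (m : ℝ) + 1 := by push_cast; ring
  rw [mul_one] at h
  rw [e]
  refine h.congr_fun ?_
  intro k
  have e2 : (((k + (m + 1 + 1) : ℕ) : ℝ) - 1) = ((k + m : ℕ) : ℝ) + 1 := by push_cast; ring
  have := choose_succ_succ_div (k + m) m
  simp only [sampleSizeProb_add, e2]
  rw [← Nat.add_assoc k m 1, mul_assoc, mul_div_right_comm, this]
  ring

/-- `E[1 / ((N - 1) (N - 2))] = p ^ 2 / ((r - 1) (r - 2))`. -/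
theorem hasSum_sampleSizeProb_div_div {r : ℕ} (hr : 3 ≤ r) {p : ℝ} (h0 : 0 < p) (h1 : p < 1) :
    HasSum (fun n : {n : ℕ // r ≤ n} =>
        sampleSizeProb r p n / (((n : ℕ) : ℝ) - 1) / (((n : ℕ) : ℝ) - 2))
      (p ^ 2 / ((r : ℝ) - 1) / ((r : ℝ) - 2)) := by
  obtain ⟨m, rfl⟩ : ∃ m, r = m + 1 + 1 + 1 := ⟨r - 3, by omega⟩
  rw [← hasSum_sampleSize_iff]
  have h := (hasSum_sampleSizeProb_add m h0 h1).mul_left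
    (p ^ 2 / ((m : ℝ) + 2) / ((m : ℝ) + 1))
  have e : (((m + 1 + 1 + 1 : ℕ) : ℝ) - 1) = (m : ℝ) + 2 := by push_cast; ring
  have e' : (((m + 1 + 1 + 1 : ℕ) : ℝ) - 2) = (m : ℝ) + 1 := by push_cast; ring
  rw [mul_one] at h
  rw [e, e']
  refine h.congr_fun ?_
  intro k
  have e2 : (((k + (m + 1 + 1 + 1) : ℕ) : ℝ) - 1) = ((k + m + 1 : ℕ) : ℝ) + 1 := by
    push_cast; ring
  have e3 : (((k + (m + 1 + 1 + 1) : ℕ) : ℝ) - 2) = ((k + m : ℕ) : ℝ) + 1 := by push_cast; ring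
  have t1 := choose_succ_succ_div (k + m + 1) (m + 1)
  have t2 := choose_succ_succ_div (k + m) m
  have e4 : (((m + 1 : ℕ) : ℝ) + 1) = (m : ℝ) + 2 := by push_cast; ring
  rw [e4] at t1
  simp only [sampleSizeProb_add, e2, e3]
  rw [show k + (m + 1 + 1) = k + m + 1 + 1 by ring, mul_assoc, mul_div_right_comm, t1,
    mul_div_right_comm, div_right_comm, t2]
  ring

/-! ### The upper bound -/

theorem optEstimator_nmse_le (r : ℕ) (hr : 3 ≤ r) {p : ℝ} (h0 : 0 < p) (h1 : p < 1) :
    (optEstimator r hr).nmse p ≤ ENNReal.ofReal (1 / ((r : ℝ) - 1)) := by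
  have hr' : (3 : ℝ) ≤ r := by exact_mod_cast hr
  have hr1 : (r : ℝ) - 1 ≠ 0 := by linarith
  have hr2 : (r : ℝ) - 2 ≠ 0 := by linarith
  set F : {n : ℕ // r ≤ n} → ℝ := fun n =>
    sampleSizeProb r p n * (((r : ℝ) - 2) / (((n : ℕ) : ℝ) - 1) - p) ^ 2 with hF
  -- The expanded square, with `1/(n-1)^2` enlarged to `1/((n-1)(n-2))` so that every sum is
  -- explicit.
  set B : {n : ℕ // r ≤ n} → ℝ := fun n =>
    ((r : ℝ) - 2) ^ 2 * (sampleSizeProb r p n / (((n : ℕ) : ℝ) - 1) / (((n : ℕ) : ℝ) - 2))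
      - 2 * p * ((r : ℝ) - 2) * (sampleSizeProb r p n / (((n : ℕ) : ℝ) - 1))
      + p ^ 2 * sampleSizeProb r p n with hB
  have hBsum : HasSum B (p ^ 2 / ((r : ℝ) - 1)) := by
    have := (((hasSum_sampleSizeProb_div_div hr h0 h1).mul_left (((r : ℝ) - 2) ^ 2)).sub
      ((hasSum_sampleSizeProb_div (by omega) h0 h1).mul_left (2 * p * ((r : ℝ) - 2)))).add
      ((hasSum_sampleSizeProb (by omega : 1 ≤ r) h0 h1).mul_left (p ^ 2))
    have hval : ((r : ℝ) - 2) ^ 2 * (p ^ 2 / ((r : ℝ) - 1) / ((r : ℝ) - 2))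
        - 2 * p * ((r : ℝ) - 2) * (p / ((r : ℝ) - 1)) + p ^ 2 * 1 = p ^ 2 / ((r : ℝ) - 1) := by
      field_simp
      ring
    rwa [hval] at this
  have hF0 : ∀ n, 0 ≤ F n := fun n =>
    mul_nonneg (sampleSizeProb_nonneg r h0 h1 n) (sq_nonneg _)
  have hFB : ∀ n, F n ≤ B n := by
    intro n
    have hn : (3 : ℝ) ≤ ((n : ℕ) : ℝ) := by exact_mod_cast hr.trans n.2
    have hf := sampleSizeProb_nonneg r h0 h1 n
    have hi : 1 / (((n : ℕ) : ℝ) - 1) ≤ 1 / (((n : ℕ) : ℝ) - 2) :=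
      one_div_le_one_div_of_le (by linarith) (by linarith)
    have hc : 0 ≤ ((r : ℝ) - 2) ^ 2 * (sampleSizeProb r p n / (((n : ℕ) : ℝ) - 1)) :=
      mul_nonneg (sq_nonneg _) (div_nonneg hf (by linarith))
    have := mul_le_mul_of_nonneg_left hi hc
    simp only [hF, hB]
    ring_nf at this ⊢
    linarith
  have hFs : Summable F := Summable.of_nonneg_of_le hF0 hFB hBsum.summable
  have hle : ∑' n, F n ≤ p ^ 2 / ((r : ℝ) - 1) := hBsum.tsum_eq ▸ hFs.tsum_le_tsum hFB hBsum.summable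
  have hexp : (optEstimator r hr).expect p (fun y => ENNReal.ofReal ((y - p) ^ 2))
      = ENNReal.ofReal (∑' n, F n) := by
    rw [ENNReal.ofReal_tsum_of_nonneg hF0 hFs]
    refine tsum_congr fun n => ?_
    simp only [hF, optEstimator, Estimator.ofFun, ProbabilityMeasure.coe_mk]
    rw [lintegral_dirac, ENNReal.ofReal_mul (sampleSizeProb_nonneg r h0 h1 n)]
  rw [Estimator.nmse, hexp, ← ENNReal.ofReal_div_of_pos (by positivity)]
  refine ENNReal.ofReal_le_ofReal ?_
  rw [div_le_iff₀ (by positivity)]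
  exact hle.trans_eq (by ring)

theorem optEstimator_supNmse_le (r : ℕ) (hr : 3 ≤ r) :
    (optEstimator r hr).supNmse ≤ ENNReal.ofReal (1 / ((r : ℝ) - 1)) :=
  iSup₂_le fun _ hp => optEstimator_nmse_le r hr hp.1 hp.2

/-! ### The lower bound: Bayes risk under the prior with density `δ * p ^ (δ - 1)` -/

/-- Integrate the derivative of `p^(s+1) (1-p)^(k+1)`, which vanishes at both ends. The ratio of the
two integrals is the Bayes estimate. -/
theorem integral_rpow_mul_one_sub_pow_succ {s : ℝ} (hs : 0 ≤ s) (k : ℕ) :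
    (s + k + 2) * ∫ p in (0 : ℝ)..1, p ^ (s + 1) * (1 - p) ^ k
      = (s + 1) * ∫ p in (0 : ℝ)..1, p ^ s * (1 - p) ^ k := by
  have hd : ∀ p ∈ Set.uIcc (0 : ℝ) 1, HasDerivAt (fun p : ℝ => p ^ (s + 1) * (1 - p) ^ (k + 1))
      ((s + 1) * (p ^ s * (1 - p) ^ k) - (s + k + 2) * (p ^ (s + 1) * (1 - p) ^ k)) p := by
    intro p hp
    rw [Set.uIcc_of_le zero_le_one] at hp
    have a := Real.hasDerivAt_rpow_const (x := p) (p := s + 1) (Or.inr (by linarith))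
    have b := ((hasDerivAt_id p).const_sub 1).pow (k + 1)
    refine (a.mul b).congr_deriv ?_
    have e : p ^ (s + 1) = p ^ s * p := by
      rw [Real.rpow_add_of_nonneg hp.1 hs zero_le_one, Real.rpow_one]
    simp only [add_sub_cancel_right, Nat.add_sub_cancel, id, e, Pi.pow_apply]
    push_cast
    ring
  have c1 : Continuous fun p : ℝ => p ^ s * (1 - p) ^ k :=
    (Real.continuous_rpow_const hs).mul (by fun_prop)
  have c2 : Continuous fun p : ℝ => p ^ (s + 1) * (1 - p) ^ k :=
    (Real.continuous_rpow_const (by linarith)).mul (by fun_prop)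
  have h := intervalIntegral.integral_eq_sub_of_hasDerivAt hd
    (((c1.const_mul _).sub (c2.const_mul _)).intervalIntegrable _ _)
  rw [intervalIntegral.integral_sub ((c1.const_mul _).intervalIntegrable _ _)
    ((c2.const_mul _).intervalIntegrable _ _), intervalIntegral.integral_const_mul,
    intervalIntegral.integral_const_mul, Real.zero_rpow (by linarith)] at h
  simp only [sub_self, ne_eq, Nat.succ_ne_zero, not_false_eq_true, zero_pow, mul_zero,
    zero_mul] at h
  linarith

/-- A continuous function which is nonnegative on `(0, 1)` has the same Lebesgue and interval
integral there. -/
theorem lintegral_Ioo_ofReal_eq {g h : ℝ → ℝ} (hg : Continuous g)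
    (h0 : ∀ p ∈ Set.Ioo (0 : ℝ) 1, 0 ≤ g p) (he : ∀ p ∈ Set.Ioo (0 : ℝ) 1, h p = g p) :
    ∫⁻ p in Set.Ioo (0 : ℝ) 1, ENNReal.ofReal (h p) = ENNReal.ofReal (∫ p in (0 : ℝ)..1, g p) := by
  rw [intervalIntegral.integral_of_le zero_le_one, integral_Ioc_eq_integral_Ioo,
    ofReal_integral_eq_lintegral_ofReal
      ((hg.integrableOn_Icc (a := 0) (b := 1)).mono_set Set.Ioo_subset_Icc_self)
      ((ae_restrict_iff' measurableSet_Ioo).2 (ae_of_all _ h0))]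
  exact setLIntegral_congr_fun measurableSet_Ioo fun p hp => by simp only [he p hp]

/-- The prior is proper only for `δ > 0`, so the limiting weight `1/p` must be approached rather
than used. -/
theorem lintegral_prior {δ : ℝ} (hδ : 0 < δ) :
    ∫⁻ p in Set.Ioo (0 : ℝ) 1, ENNReal.ofReal (δ * p ^ (δ - 1)) = 1 := by
  have hi : IntervalIntegrable (fun p : ℝ => δ * p ^ (δ - 1)) volume 0 1 :=
    (intervalIntegral.intervalIntegrable_rpow' (by linarith)).const_mul δ
  rw [← ofReal_integral_eq_lintegral_ofReal
    (((intervalIntegrable_iff_integrableOn_Ioo_of_le zero_le_one).1 hi))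
    ((ae_restrict_iff' measurableSet_Ioo).2 (ae_of_all _ fun p hp =>
      mul_nonneg hδ.le (Real.rpow_nonneg hp.1.le _))),
    ← integral_Ioc_eq_integral_Ioo, ← intervalIntegral.integral_of_le zero_le_one,
    intervalIntegral.integral_const_mul, integral_rpow (Or.inl (by linarith))]
  rw [sub_add_cancel, Real.one_rpow, Real.zero_rpow hδ.ne', sub_zero, mul_one_div_cancel hδ.ne',
    ENNReal.ofReal_one]

/-- The posterior risk of the value `y` given `N = n` is at least that of the Bayes estimate
`(r + δ - 2) / (n + δ - 1)`. -/
theorem lintegral_posterior_le {r : ℕ} (hr : 3 ≤ r) {δ : ℝ} (hδ : 0 < δ) (n : {n : ℕ // r ≤ n})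
    (y : ℝ) :
    ∫⁻ p in Set.Ioo (0 : ℝ) 1, ENNReal.ofReal (sampleSizeProb r p n * (δ * p ^ (δ - 1)))
      ≤ (∫⁻ p in Set.Ioo (0 : ℝ) 1,
          ENNReal.ofReal (sampleSizeProb r p n * (y - p) ^ 2 / p ^ 2 * (δ * p ^ (δ - 1))))
        + ∫⁻ p in Set.Ioo (0 : ℝ) 1, ENNReal.ofReal (sampleSizeProb r p n
            * (((r : ℝ) + δ - 2) / (((n : ℕ) : ℝ) + δ - 1)) / p * (δ * p ^ (δ - 1))) := by
  obtain ⟨n, hn⟩ := n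
  obtain ⟨k, rfl⟩ := Nat.exists_eq_add_of_le hn
  obtain ⟨m, rfl⟩ : ∃ m, r = m + 3 := ⟨r - 3, by omega⟩
  -- Exponent `r + δ - 3`: `p^r` from the likelihood, `p^(-2)` from the normalization, `p^(δ-1)`
  -- from the prior.
  set s : ℝ := (m : ℝ) + δ with hs
  have hs0 : 0 < s := by positivity
  set K : ℝ := ((m + 3 + k - 1).descFactorial (m + 3 - 1) : ℝ) / ((m + 3 - 1).factorial : ℝ) * δ
    with hK
  have hK0 : 0 ≤ K := by positivity
  set z : ℝ := (((m + 3 : ℕ) : ℝ) + δ - 2) / (((m + 3 + k : ℕ) : ℝ) + δ - 1) with hz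
  have hz' : z = (s + 1) / (s + k + 2) := by
    rw [hz, hs]
    push_cast
    congr 1 <;> ring
  have hz0 : 0 ≤ z := by rw [hz']; positivity
  have c0 : Continuous fun p : ℝ => p ^ s * (1 - p) ^ k :=
    (Real.continuous_rpow_const hs0.le).mul (by fun_prop)
  have c1 : Continuous fun p : ℝ => p ^ (s + 1) * (1 - p) ^ k :=
    (Real.continuous_rpow_const (by linarith)).mul (by fun_prop)
  have c2 : Continuous fun p : ℝ => p ^ (s + 2) * (1 - p) ^ k :=
    (Real.continuous_rpow_const (by linarith)).mul (by fun_prop)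
  have e1 : ∀ p : ℝ, 0 < p → p ^ (s + 1) = p ^ s * p := fun p hp => Real.rpow_add_one hp.ne' s
  have e2 : ∀ p : ℝ, 0 < p → p ^ (s + 2) = p ^ s * p ^ 2 := fun p hp => by
    rw [Real.rpow_add hp, Real.rpow_two]
  have ef : ∀ p : ℝ, 0 < p →
      sampleSizeProb (m + 3) p ⟨m + 3 + k, hn⟩ * (δ * p ^ (δ - 1))
        = K * (p ^ s * p ^ 2 * (1 - p) ^ k) := by
    intro p hp
    have : p ^ (m + 3) * p ^ (δ - 1) = p ^ s * p ^ 2 := by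
      rw [← Real.rpow_natCast, ← Real.rpow_natCast, ← Real.rpow_add hp, ← Real.rpow_add hp]
      congr 1
      rw [hs]
      push_cast
      ring
    simp only [sampleSizeProb, hK, Nat.add_sub_cancel_left]
    linear_combination (((m + 3 + k - 1).descFactorial (m + 3 - 1) : ℝ)
      / ((m + 3 - 1).factorial : ℝ) * δ * (1 - p) ^ k) * this
  have pos : ∀ p ∈ Set.Ioo (0 : ℝ) 1, ∀ t : ℝ, 0 ≤ p ^ t * (1 - p) ^ k := fun p hp t =>
    mul_nonneg (Real.rpow_nonneg hp.1.le _) (pow_nonneg (by linarith [hp.2]) _)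
  rw [lintegral_Ioo_ofReal_eq (g := fun p => K * (p ^ (s + 2) * (1 - p) ^ k)) (c2.const_mul K)
      (fun p hp => mul_nonneg hK0 (pos p hp _))
      (fun p hp => by rw [ef p hp.1, e2 p hp.1]),
    lintegral_Ioo_ofReal_eq (g := fun p => K * y ^ 2 * (p ^ s * (1 - p) ^ k)
        - 2 * K * y * (p ^ (s + 1) * (1 - p) ^ k) + K * (p ^ (s + 2) * (1 - p) ^ k))
      (((c0.const_mul _).sub (c1.const_mul _)).add (c2.const_mul _))
      (fun p hp => by
        rw [e1 p hp.1, e2 p hp.1]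
        have := mul_nonneg (mul_nonneg hK0 (pos p hp s)) (sq_nonneg (y - p))
        linarith)
      (fun p hp => by
        have hp0 := hp.1.ne'
        have := ef p hp.1
        generalize sampleSizeProb (m + 3) p ⟨m + 3 + k, hn⟩ = f at this ⊢
        rw [e1 p hp.1, e2 p hp.1]
        calc _ = f * (δ * p ^ (δ - 1))
                * (y - p) ^ 2 / p ^ 2 := by ring
          _ = _ := by rw [this]; field_simp; ring),
    lintegral_Ioo_ofReal_eq (g := fun p => K * z * (p ^ (s + 1) * (1 - p) ^ k))
      (c1.const_mul (K * z)) (fun p hp => mul_nonneg (mul_nonneg hK0 hz0) (pos p hp _))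
      (fun p hp => by
        have hp0 := hp.1.ne'
        have := ef p hp.1
        generalize sampleSizeProb (m + 3) p ⟨m + 3 + k, hn⟩ = f at this ⊢
        rw [e1 p hp.1]
        calc _ = f * (δ * p ^ (δ - 1)) * z / p := by ring
          _ = _ := by rw [this]; field_simp)]
  refine (ENNReal.ofReal_le_ofReal ?_).trans ENNReal.ofReal_add_le
  have i0 := c0.intervalIntegrable (μ := volume) 0 1
  have i1 := c1.intervalIntegrable (μ := volume) 0 1
  have i2 := c2.intervalIntegrable (μ := volume) 0 1
  rw [intervalIntegral.integral_add ((i0.const_mul _).sub (i1.const_mul _)) (i2.const_mul _),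
    intervalIntegral.integral_sub (i0.const_mul _) (i1.const_mul _)]
  simp only [intervalIntegral.integral_const_mul]
  have hrel := integral_rpow_mul_one_sub_pow_succ hs0.le k
  have hc : 0 ≤ ∫ p in (0 : ℝ)..1, p ^ s * (1 - p) ^ k := by
    refine intervalIntegral.integral_nonneg zero_le_one fun p hp => ?_
    exact mul_nonneg (Real.rpow_nonneg hp.1 _) (pow_nonneg (by linarith [hp.2]) _)
  set c := ∫ p in (0 : ℝ)..1, p ^ s * (1 - p) ^ k
  set b := ∫ p in (0 : ℝ)..1, p ^ (s + 1) * (1 - p) ^ k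
  have hb : b = z * c := by
    rw [hz']
    field_simp
    linarith
  -- After `b = z * c`, the two sides differ by exactly `K c (y - z)^2`.
  have := mul_nonneg (mul_nonneg hK0 hc) (sq_nonneg (y - z))
  rw [hb]
  linarith

theorem measurable_sampleSizeProb (r : ℕ) (n : {n : ℕ // r ≤ n}) :
    Measurable fun p => sampleSizeProb r p n := by
  unfold sampleSizeProb
  fun_prop

/-- Integrate the posterior inequality over the law of the estimator and sum over `n`. The additive
form avoids truncated subtraction in `ℝ≥0∞`. -/
theorem one_le_supNmse_add {r : ℕ} (hr : 3 ≤ r) (G : Estimator r) {δ : ℝ} (hδ : 0 < δ) :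
    1 ≤ G.supNmse + ENNReal.ofReal (((r : ℝ) + δ - 2) / ((r : ℝ) - 1)) := by
  have hr' : (3 : ℝ) ≤ r := by exact_mod_cast hr
  have hw : ∀ p ∈ Set.Ioo (0 : ℝ) 1, 0 ≤ δ * p ^ (δ - 1) := fun p hp =>
    mul_nonneg hδ.le (Real.rpow_nonneg hp.1.le _)
  have hwm : Measurable fun p : ℝ => δ * p ^ (δ - 1) := by fun_prop
  -- the joint measurability of the loss
  have hmeas : ∀ n : {n : ℕ // r ≤ n}, Measurable (Function.uncurry fun (p y : ℝ) =>
      ENNReal.ofReal (sampleSizeProb r p n * (y - p) ^ 2 / p ^ 2 * (δ * p ^ (δ - 1)))) := by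
    intro n
    have h1 : Measurable fun q : ℝ × ℝ => sampleSizeProb r q.1 n :=
      (measurable_sampleSizeProb r n).comp measurable_fst
    have h2 : Measurable fun q : ℝ × ℝ => δ * q.1 ^ (δ - 1) := hwm.comp measurable_fst
    exact (((h1.mul ((measurable_snd.sub measurable_fst).pow_const 2)).div
      (measurable_fst.pow_const 2)).mul h2).ennreal_ofReal
  have hprior : (1 : ℝ≥0∞) = ∑' n : {n : ℕ // r ≤ n}, ∫⁻ p in Set.Ioo (0 : ℝ) 1,
      ENNReal.ofReal (sampleSizeProb r p n * (δ * p ^ (δ - 1))) := by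
    have hm : ∀ n : {n : ℕ // r ≤ n}, Measurable fun p : ℝ =>
        ENNReal.ofReal (sampleSizeProb r p n * (δ * p ^ (δ - 1))) := fun n =>
      ((measurable_sampleSizeProb r n).mul hwm).ennreal_ofReal
    rw [← lintegral_tsum fun n => (hm n).aemeasurable, ← lintegral_prior hδ]
    refine setLIntegral_congr_fun measurableSet_Ioo fun p hp => ?_
    have h := (hasSum_sampleSizeProb (by omega : 1 ≤ r) hp.1 hp.2).mul_right (δ * p ^ (δ - 1))
    rw [← ENNReal.ofReal_tsum_of_nonneg
      (fun n => mul_nonneg (sampleSizeProb_nonneg r hp.1 hp.2 n) (hw p hp)) h.summable,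
      h.tsum_eq, one_mul]
  have hrisk : (∑' n : {n : ℕ // r ≤ n}, ∫⁻ y, (∫⁻ p in Set.Ioo (0 : ℝ) 1,
      ENNReal.ofReal (sampleSizeProb r p n * (y - p) ^ 2 / p ^ 2 * (δ * p ^ (δ - 1))))
        ∂(G.law n : Measure ℝ)) ≤ G.supNmse := by
    have hswap : ∀ n : {n : ℕ // r ≤ n}, (∫⁻ y, (∫⁻ p in Set.Ioo (0 : ℝ) 1,
        ENNReal.ofReal (sampleSizeProb r p n * (y - p) ^ 2 / p ^ 2 * (δ * p ^ (δ - 1))))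
          ∂(G.law n : Measure ℝ)) = ∫⁻ p in Set.Ioo (0 : ℝ) 1, ∫⁻ y,
        ENNReal.ofReal (sampleSizeProb r p n * (y - p) ^ 2 / p ^ 2 * (δ * p ^ (δ - 1)))
          ∂(G.law n : Measure ℝ) := fun n =>
      (lintegral_lintegral_swap (hmeas n).aemeasurable).symm
    rw [tsum_congr hswap, ← lintegral_tsum fun n =>
      (Measurable.lintegral_prod_right (hmeas n)).aemeasurable]
    calc _ ≤ ∫⁻ p in Set.Ioo (0 : ℝ) 1, G.supNmse * ENNReal.ofReal (δ * p ^ (δ - 1)) := by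
          refine setLIntegral_mono' measurableSet_Ioo fun p hp => ?_
          have hle : G.nmse p ≤ G.supNmse := le_iSup₂ (f := fun p _ => G.nmse p) p hp
          refine le_trans (le_of_eq ?_) (mul_le_mul_left hle _)
          have hp2 : 0 < p ^ 2 := pow_pos hp.1 2
          rw [Estimator.nmse, Estimator.expect, div_eq_mul_inv, mul_assoc, ← ENNReal.tsum_mul_right]
          refine tsum_congr fun n => ?_
          have hf := sampleSizeProb_nonneg r hp.1 hp.2 n
          have hm : Measurable fun y : ℝ => ENNReal.ofReal ((y - p) ^ 2) := by fun_prop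
          rw [← lintegral_const_mul _ hm, ← lintegral_mul_const _ (hm.const_mul _)]
          refine lintegral_congr fun y => ?_
          rw [ENNReal.ofReal_mul (div_nonneg (mul_nonneg hf (sq_nonneg _)) hp2.le),
            ENNReal.ofReal_div_of_pos hp2, ENNReal.ofReal_mul hf, div_eq_mul_inv, mul_assoc]
      _ = G.supNmse := by
          rw [lintegral_const_mul _ hwm.ennreal_ofReal, lintegral_prior hδ, mul_one]
  have hcorr : (∑' n : {n : ℕ // r ≤ n}, ∫⁻ p in Set.Ioo (0 : ℝ) 1, ENNReal.ofReal
      (sampleSizeProb r p n * (((r : ℝ) + δ - 2) / (((n : ℕ) : ℝ) + δ - 1)) / p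
        * (δ * p ^ (δ - 1)))) ≤ ENNReal.ofReal (((r : ℝ) + δ - 2) / ((r : ℝ) - 1)) := by
    have hm : ∀ n : {n : ℕ // r ≤ n}, Measurable fun p : ℝ => ENNReal.ofReal
        (sampleSizeProb r p n * (((r : ℝ) + δ - 2) / (((n : ℕ) : ℝ) + δ - 1)) / p
          * (δ * p ^ (δ - 1))) := fun n =>
      ((((measurable_sampleSizeProb r n).mul_const _).div measurable_id).mul hwm).ennreal_ofReal
    rw [← lintegral_tsum fun n => (hm n).aemeasurable]
    calc _ ≤ ∫⁻ p in Set.Ioo (0 : ℝ) 1, ENNReal.ofReal (((r : ℝ) + δ - 2) / ((r : ℝ) - 1))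
            * ENNReal.ofReal (δ * p ^ (δ - 1)) := by
          refine setLIntegral_mono' measurableSet_Ioo fun p hp => ?_
          have hp0 := hp.1
          have h := ((hasSum_sampleSizeProb_div (by omega : 2 ≤ r) hp.1 hp.2).mul_left
            (((r : ℝ) + δ - 2) / p * (δ * p ^ (δ - 1))))
          have hc : 0 ≤ ((r : ℝ) + δ - 2) / p * (δ * p ^ (δ - 1)) :=
            mul_nonneg (div_nonneg (by linarith) hp0.le) (hw p hp)
          have hval : ((r : ℝ) + δ - 2) / p * (δ * p ^ (δ - 1)) * (p / ((r : ℝ) - 1))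
              = ((r : ℝ) + δ - 2) / ((r : ℝ) - 1) * (δ * p ^ (δ - 1)) := by
            field_simp
          rw [hval] at h
          rw [← ENNReal.ofReal_mul (div_nonneg (by linarith) (by linarith)), ← h.tsum_eq,
            ENNReal.ofReal_tsum_of_nonneg _ h.summable]
          · refine ENNReal.tsum_le_tsum fun n => ENNReal.ofReal_le_ofReal ?_
            have hn : (r : ℝ) ≤ ((n : ℕ) : ℝ) := by exact_mod_cast n.2
            have hf := sampleSizeProb_nonneg r hp.1 hp.2 n
            -- Dropping `δ` from the denominator brings in the exact value of `E[1/(N-1)]`.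
            have hi : 1 / (((n : ℕ) : ℝ) + δ - 1) ≤ 1 / (((n : ℕ) : ℝ) - 1) :=
              one_div_le_one_div_of_le (by linarith) (by linarith)
            have := mul_le_mul_of_nonneg_left hi (mul_nonneg hc hf)
            refine le_trans (le_of_eq ?_) (this.trans (le_of_eq ?_)) <;> ring
          · intro n
            have hn : (r : ℝ) ≤ ((n : ℕ) : ℝ) := by exact_mod_cast n.2
            exact mul_nonneg hc
              (div_nonneg (sampleSizeProb_nonneg r hp.1 hp.2 n) (by linarith))
      _ = _ := by rw [lintegral_const_mul _ hwm.ennreal_ofReal, lintegral_prior hδ, mul_one]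
  refine le_trans ?_ (add_le_add hrisk hcorr)
  rw [hprior, ← ENNReal.tsum_add]
  refine ENNReal.tsum_le_tsum fun n => ?_
  calc _ = ∫⁻ _, (∫⁻ p in Set.Ioo (0 : ℝ) 1,
        ENNReal.ofReal (sampleSizeProb r p n * (δ * p ^ (δ - 1)))) ∂(G.law n : Measure ℝ) := by
        rw [lintegral_const, measure_univ, mul_one]
    _ ≤ _ := lintegral_mono fun y => lintegral_posterior_le hr hδ n y
    _ = _ := by
        rw [lintegral_add_right _ measurable_const, lintegral_const, measure_univ, mul_one]

theorem le_supNmse {r : ℕ} (hr : 3 ≤ r) (G : Estimator r) :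
    ENNReal.ofReal (1 / ((r : ℝ) - 1)) ≤ G.supNmse := by
  have hr' : (3 : ℝ) ≤ r := by exact_mod_cast hr
  rcases eq_or_ne G.supNmse ⊤ with h | hS
  · rw [h]
    exact le_top
  rw [ENNReal.ofReal_le_iff_le_toReal hS]
  have key : ∀ δ : ℝ, 0 < δ → 1 ≤ G.supNmse.toReal + ((r : ℝ) + δ - 2) / ((r : ℝ) - 1) := by
    intro δ hδ
    have h0 : 0 ≤ ((r : ℝ) + δ - 2) / ((r : ℝ) - 1) := div_nonneg (by linarith) (by linarith)
    have h := one_le_supNmse_add hr G hδ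
    have := ENNReal.toReal_mono (by finiteness) h
    rwa [ENNReal.toReal_add hS ENNReal.ofReal_ne_top, ENNReal.toReal_ofReal h0,
      ENNReal.toReal_one] at this
  refine le_of_forall_pos_le_add fun ε hε => ?_
  have hr1 : (r : ℝ) - 1 ≠ 0 := by linarith
  -- This `δ` makes the loss `δ/(r-1)` equal to `ε`.
  have h := key (ε * ((r : ℝ) - 1)) (mul_pos hε (by linarith))
  have e : ((r : ℝ) + ε * ((r : ℝ) - 1) - 2) / ((r : ℝ) - 1) = 1 + ε - 1 / ((r : ℝ) - 1) := by
    field_simp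
    ring
  linarith

end InverseBinomial

theorem mainTheorem6 (r : ℕ) (hr : 3 ≤ r) :
    (∀ G : InverseBinomial.Estimator r,
      (InverseBinomial.optEstimator r hr).supNmse ≤ G.supNmse) ∧
    (InverseBinomial.optEstimator r hr).supNmse = ENNReal.ofReal (1 / ((r : ℝ) - 1)) :=
  ⟨fun G => (InverseBinomial.optEstimator_supNmse_le r hr).trans (InverseBinomial.le_supNmse hr G),
    (InverseBinomial.optEstimator_supNmse_le r hr).antisymm (InverseBinomial.le_supNmse hr _)⟩
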